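/- Let $S$ and $A$ be sets with $|S|=|A|=2$. Consider a nonlocal game $\mathcal G$ in which both players have question set $S$ and answer set $A$, given by a probability distribution $\pi$ on $S\times S$ and a predicate $V:A\times A\times S\times S\to\{0,1\}$. The winning probability of a correlation $p=(p(a,b|s,t))$ is $\sum_{s,t}\pi(s,t)\sum_{a,b}V(a,b|s,t)\,p(a,b|s,t)$. A correlation ($p\ge 0$, $\sum_{a,b}p(a,b|s,t)=1$ for all $s,t$) is synchronous if $p(a,a'|s,s)=0$ for all $s$ and all $a\ne a'$. Let $\mathcal{CP}^n$ be the cone of Gram matrices of $n$ entrywise nonnegative real vectors, $\mathcal{CS}_+^n$ the cone of Gram matrices (for $\langle P,Q\rangle=\mathrm{Tr}(PQ)$) of $n$ real symmetric positive semidefinite matrices of a common size, and $\mathcal{DNN}^n$ the cone of $n\times n$ positive semidefinite, entrywise nonnegative matrices. For $\mathcal K\in\{\mathcal{CP},\mathcal{CS}_+\}$, a $\mathcal K$-correlation is a vector $p$ for which there is $X\in\mathcal K^{2|S||A|}$, with rows and columns indexed by two disjoint copies of $S\times A$ (one per player), such that each block of $X$ indexed by an ordered pair of questions (each taken from either copy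 of $S$) has entry sum $1$ and $X[(s,a),(t,b)]=p(a,b|s,t)$ for $(s,a)$ in the first and $(t,b)$ in the second copy. Let $\omega_{syn}(\mathcal K,\mathcal G)$ be the supremum of the winning probability over synchronous $\mathcal K$-correlations. With $C[(s,a),(t,b)]=\pi(s,t)V(a,b|s,t)$, let $\nu(\mathcal{DNN},\mathcal G)$ be the supremum of $\tfrac12\langle C+C^{\mathsf T},X\rangle$ over $X\in\mathcal{DNN}^{|S\times A|}$ such that $\sum_{a,a'}X[(s,a),(s',a')]=1$ for all $s,s'\in S$ and $X[(s,a),(s,a')]=0$ for all $s\in S$, $a\ne a'\in A$. Then $$\omega_{syn}(\mathcal{CP},\mathcal G)=\omega_{syn}(\mathcal{CS}_+,\mathcal G)=\nu(\mathcal{DNN},\mathcal G).$$ Moreover, the supremum of the winning probability over synchronous classical correlations ($p(a,b|s,t)=\sum_{i=1}^n k_i x^{s,i}_a y^{t,i}_b$ for a probability vector $(k_i)$ and probability distributions $x^{s,i},y^{t,i}$ on $A$) and the supremum over synchronous quantum correlations ($p(a,b|s,t)=\psi^*(X^s_a\otimes Y^t_b)\psi$ for a unit vector $\psi$ in a tensor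 product of two finite-dimensional complex Euclidean spaces and Hermitian positive semidefinite operators with $\sum_aX^s_a=I$ and $\sum_bY^t_b=I$) are both equal to $\nu(\mathcal{DNN},\mathcal G)$. All five suprema are attained. For the CHSH game ($S=A=\{0,1\}$, $\pi$ uniform, $V(a,b|s,t)=1$ if and only if $a\oplus b=s\cdot t$) the synchronous quantum value is $3/4$, both as the supremum over synchronous quantum correlations and as $\omega_{syn}(\mathcal{CS}_+,\cdot)$, and the synchronous classical value (the supremum over synchronous classical correlations) is also $3/4$. -/

import Mathlib

open scoped Matrix Kronecker ComplexOrder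

noncomputable section

/-- A two-player one-round nonlocal game with question sets `S`, `T` and answer sets `A`, `B`:
a probability distribution `π` on `S × T` and a Boolean predicate `V` (`V a b s t` is
`V(a,b|s,t)`). -/
structure NonlocalGame (S T A B : Type*) [Fintype S] [Fintype T] where
  π : S → T → ℝ
  V : A → B → S → T → Bool
  π_nonneg : ∀ s t, 0 ≤ π s t
  π_sum : ∑ s, ∑ t, π s t = 1

namespace NonlocalGame

section Cones

variable (ι : Type*)

/-- The completely positive cone: Gram matrices of entrywise nonnegative real vectors. -/
def completelyPositive : Set (Matrix ι ι ℝ) :=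
  {X | ∃ d : ℕ, 1 ≤ d ∧ ∃ x : ι → Fin d → ℝ,
    (∀ i k, 0 ≤ x i k) ∧ ∀ i j, X i j = x i ⬝ᵥ x j}

/-- The completely positive semidefinite cone: Gram matrices, for the inner product
`⟨P, Q⟩ = Tr (P Q)`, of real symmetric positive semidefinite matrices. -/
def completelyPSD : Set (Matrix ι ι ℝ) :=
  {X | ∃ d : ℕ, 1 ≤ d ∧ ∃ P : ι → Matrix (Fin d) (Fin d) ℝ,
    (∀ i, (P i).PosSemidef) ∧ ∀ i j, X i j = (P i * P j).trace}

/-- The doubly nonnegative cone: positive semidefinite and entrywise nonnegative matrices. -/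
def doublyNonneg : Set (Matrix ι ι ℝ) :=
  {X | X.PosSemidef ∧ ∀ i j, 0 ≤ X i j}

end Cones

section Correlations

variable (S T A B : Type*) [Fintype A] [Fintype B]

/-- The set of all correlations; `p a b s t` stands for `p(a,b|s,t)`. -/
def correlations : Set (A → B → S → T → ℝ) :=
  {p | (∀ a b s t, 0 ≤ p a b s t) ∧ ∀ s t, ∑ a, ∑ b, p a b s t = 1}

/-- Classical correlations: those generated with shared and private randomness. -/
def classicalCorrelations : Set (A → B → S → T → ℝ) :=
  {p | ∃ (n : ℕ) (k : Fin n → ℝ) (x : S → Fin n → A → ℝ) (y : T → Fin n → B → ℝ),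
    (∀ i, 0 ≤ k i) ∧ (∀ s i a, 0 ≤ x s i a) ∧ (∀ t i b, 0 ≤ y t i b) ∧
    ∑ i, k i = 1 ∧ (∀ s i, ∑ a, x s i a = 1) ∧ (∀ t i, ∑ b, y t i b = 1) ∧
    ∀ a b s t, p a b s t = ∑ i, k i * x s i a * y t i b}

/-- Quantum correlations: those generated by local measurements on a shared pure state `ψ` in a
tensor product `ℂ^m ⊗ ℂ^n` of finite dimensional complex Euclidean spaces. -/
def quantumCorrelations : Set (A → B → S → T → ℝ) :=
  {p | ∃ (m n : ℕ) (ψ : Fin m × Fin n → ℂ)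
      (X : S → A → Matrix (Fin m) (Fin m) ℂ) (Y : T → B → Matrix (Fin n) (Fin n) ℂ),
    star ψ ⬝ᵥ ψ = 1 ∧
    (∀ s a, (X s a).PosSemidef) ∧ (∀ s, ∑ a, X s a = 1) ∧
    (∀ t b, (Y t b).PosSemidef) ∧ (∀ t, ∑ b, Y t b = 1) ∧
    ∀ a b s t, (p a b s t : ℂ) = star ψ ⬝ᵥ ((X s a ⊗ₖ Y t b) *ᵥ ψ)}

variable {S T A B}

/-- The sum `⟨J_{i,j}, X⟩` of all entries in the block `(i,j)`, `i, j ∈ S ∪ T` (disjoint union),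
of a square matrix with rows and columns indexed by `S × A` and `T × B`. -/
def blockSum (X : Matrix ((S × A) ⊕ (T × B)) ((S × A) ⊕ (T × B)) ℝ) : S ⊕ T → S ⊕ T → ℝ
  | .inl s, .inl s' => ∑ a, ∑ a', X (.inl (s, a)) (.inl (s', a'))
  | .inl s, .inr t => ∑ a, ∑ b, X (.inl (s, a)) (.inr (t, b))
  | .inr t, .inl s => ∑ b, ∑ a, X (.inr (t, b)) (.inl (s, a))
  | .inr t, .inr t' => ∑ b, ∑ b', X (.inr (t, b)) (.inr (t', b'))

/-- The set `Corr(K)` of `K`-correlations. -/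
def conicCorrelations (K : Set (Matrix ((S × A) ⊕ (T × B)) ((S × A) ⊕ (T × B)) ℝ)) :
    Set (A → B → S → T → ℝ) :=
  {p | ∃ X ∈ K, (∀ i j, blockSum X i j = 1) ∧
    ∀ a b s t, X (.inl (s, a)) (.inr (t, b)) = p a b s t}

variable (S A) in
/-- Synchronous correlations (`S = T`, `A = B`): equal questions never get distinct answers. -/
def synchronousCorrelations : Set (A → A → S → S → ℝ) :=
  {p | p ∈ correlations S S A A ∧ ∀ s a a', a ≠ a' → p a a' s s = 0}

end Correlations

section Values

variable {S T A B : Type*} [Fintype S] [Fintype T] [Fintype A] [Fintype B]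

/-- The probability of winning `G` with a strategy that generates the correlation `p`. -/
def winProb (G : NonlocalGame S T A B) (p : A → B → S → T → ℝ) : ℝ :=
  ∑ s, ∑ t, G.π s t * ∑ a, ∑ b, (if G.V a b s t then 1 else 0) * p a b s t

/-- The winning probabilities achieved by the synchronous correlations in the set `𝒮`. -/
def syncWinProbs (G : NonlocalGame S S A A) (𝒮 : Set (A → A → S → S → ℝ)) : Set ℝ :=
  G.winProb '' (𝒮 ∩ synchronousCorrelations S A)

/-- The value of `G` when only synchronous correlations in the set `𝒮` may be used. -/
def syncValue (G : NonlocalGame S S A A) (𝒮 : Set (A → A → S → S → ℝ)) : ℝ :=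
  sSup (G.syncWinProbs 𝒮)

/-- The `K`-synchronous value, for a cone `K` of matrices indexed by two copies of `S × A`. -/
def conicSyncValue (K : Set (Matrix ((S × A) ⊕ (S × A)) ((S × A) ⊕ (S × A)) ℝ))
    (G : NonlocalGame S S A A) : ℝ :=
  G.syncValue (conicCorrelations K)

/-- The cost matrix `C[(s,a),(t,b)] = π(s,t) V(a,b|s,t)`. -/
def costMatrix (G : NonlocalGame S T A B) : Matrix (S × A) (T × B) ℝ :=
  Matrix.of fun i j => G.π i.1 j.1 * (if G.V i.2 j.2 i.1 j.1 then 1 else 0)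

/-- The objective values at the feasible points of the conic program `ν(K, G)`. -/
def nuValues (K : Set (Matrix (S × A) (S × A) ℝ)) (G : NonlocalGame S S A A) : Set ℝ :=
  (fun X => (1 / 2 : ℝ) * ((G.costMatrix + G.costMatrixᵀ) * X).trace) ''
    {X | X ∈ K ∧ (∀ s s', ∑ a, ∑ a', X (s, a) (s', a') = 1) ∧
      ∀ s a a', a ≠ a' → X (s, a) (s, a') = 0}

/-- The optimal value `ν(K, G)` of that program. -/
def nu (K : Set (Matrix (S × A) (S × A) ℝ)) (G : NonlocalGame S S A A) : ℝ :=
  sSup (nuValues K G)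

end Values

/-- The CHSH game: uniform questions, and the players win iff `a ⊕ b = s · t`. -/
def chsh : NonlocalGame Bool Bool Bool Bool where
  π := fun _ _ => 1 / 4
  V := fun a b s t => xor a b == (s && t)
  π_nonneg := by intros; norm_num
  π_sum := by norm_num

end NonlocalGame

end

open NonlocalGame

/-! All five suprema equal the best winning probability of a deterministic strategy `f : S → A`
shared by both players. Each such strategy gives a synchronous classical, quantum and conic
correlation, and a feasible point of the doubly nonnegative program, so that value is reached
everywhere. For the upper bound, synchrony forces the vectors representing the two players to
coincide, so `p` itself, read as a matrix on `S × A`, is feasible for the program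
(`corrMatrix_mem_feasible_of_conic`, `corrMatrix_mem_feasible_of_quantum`). With two questions a
feasible matrix is a convex mixture of deterministic strategies (`exists_mixture_of_mem_feasible`),
and winning probability is linear. -/

namespace NonlocalGame

/-! ### Gram matrices and the cone inclusions -/

section PosSemidef

variable {ι : Type*} [Fintype ι]

/-- Two families of Gram vectors whose sums are at distance zero have the same sum. -/
lemma sum_col_eq_of_posSemidef {α β : Type*} [Fintype α] [Fintype β] {X : Matrix ι ι ℝ}
    (hX : X.PosSemidef) (u : α → ι) (v : β → ι)
    (h : ∑ a, ∑ a', X (u a) (u a') + ∑ b, ∑ b', X (v b) (v b') - ∑ a, ∑ b, X (u a) (v b)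
      - ∑ b, ∑ a, X (v b) (u a) = 0) (k : ι) :
    ∑ a, X k (u a) = ∑ b, X k (v b) := by
  classical
  -- The hypothesis says that the quadratic form of `X` vanishes at `w`; semidefiniteness then gives
  -- `X w = 0`.
  set w : ι → ℝ := ∑ a, Pi.single (u a) 1 - ∑ b, Pi.single (v b) 1 with hw
  have hXw : ∀ k, (X *ᵥ w) k = ∑ a, X k (u a) - ∑ b, X k (v b) := by
    intro k
    simp [hw, Matrix.mulVec_sub, Matrix.mulVec_sum, Finset.sum_apply]
  have h0 : star w ⬝ᵥ (X *ᵥ w) = 0 := by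
    have : star w = w := by ext; simp
    rw [this, ← h]
    conv_lhs => enter [1]; rw [hw]
    simp only [sub_dotProduct, sum_dotProduct, single_one_dotProduct, hXw,
      Finset.sum_sub_distrib]
    ring
  have h1 := congrFun ((hX.dotProduct_mulVec_zero_iff w).1 h0) k
  rw [hXw] at h1
  simpa [sub_eq_zero] using h1

lemma posSemidef_of_sum_nonneg {X : Matrix ι ι ℝ} (hs : ∀ i j, X i j = X j i)
    (h : ∀ c : ι → ℝ, 0 ≤ ∑ i, ∑ j, c i * c j * X i j) : X.PosSemidef := by
  refine .of_dotProduct_mulVec_nonneg (by ext i j; simp [hs i j]) fun c => ?_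
  refine (h c).trans_eq ?_
  simp only [dotProduct, Matrix.mulVec, Finset.mul_sum, Pi.star_apply, star_trivial]
  exact Finset.sum_congr rfl fun i _ => Finset.sum_congr rfl fun j _ => by ring

open scoped MatrixOrder in
lemma trace_mul_nonneg_of_posSemidef {P Q : Matrix ι ι ℝ} (hP : P.PosSemidef)
    (hQ : Q.PosSemidef) : 0 ≤ (P * Q).trace := by
  classical
  obtain ⟨B, rfl⟩ := CStarAlgebra.nonneg_iff_eq_star_mul_self.mp hP.nonneg
  rw [Matrix.star_eq_conjTranspose, Matrix.mul_assoc, Matrix.trace_mul_comm]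
  exact (hQ.mul_mul_conjTranspose_same B).trace_nonneg

lemma completelyPositive_subset_doublyNonneg :
    completelyPositive ι ⊆ doublyNonneg ι := by
  rintro X ⟨d, -, x, hx, hX⟩
  refine ⟨posSemidef_of_sum_nonneg (fun i j => by rw [hX, hX, dotProduct_comm]) fun c => ?_,
    fun i j => hX i j ▸ Finset.sum_nonneg fun k _ => mul_nonneg (hx i k) (hx j k)⟩
  have : ∑ i, ∑ j, c i * c j * X i j = (∑ i, c i • x i) ⬝ᵥ (∑ i, c i • x i) := by
    simp only [sum_dotProduct, dotProduct_sum, smul_dotProduct, dotProduct_smul, hX, smul_eq_mul,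
      Finset.mul_sum]
    exact Finset.sum_congr rfl fun i _ => Finset.sum_congr rfl fun j _ => by
      rw [dotProduct_comm]; ring
  rw [this]
  exact Finset.sum_nonneg fun k _ => mul_self_nonneg _

lemma completelyPSD_subset_doublyNonneg :
    completelyPSD ι ⊆ doublyNonneg ι := by
  rintro X ⟨d, -, P, hP, hX⟩
  refine ⟨posSemidef_of_sum_nonneg (fun i j => by rw [hX, hX, Matrix.trace_mul_comm])
    fun c => ?_, fun i j => hX i j ▸ trace_mul_nonneg_of_posSemidef (hP i) (hP j)⟩
  have hH : (∑ i, c i • P i)ᴴ = ∑ i, c i • P i := by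
    rw [Matrix.conjTranspose_sum]
    exact Finset.sum_congr rfl fun i _ => by
      rw [Matrix.conjTranspose_smul, (hP i).isHermitian.eq, star_trivial]
  have : ∑ i, ∑ j, c i * c j * X i j = ((∑ i, c i • P i)ᴴ * ∑ i, c i • P i).trace := by
    simp only [hH, Matrix.sum_mul, Matrix.trace_sum, Matrix.smul_mul,
      Matrix.mul_smul, Matrix.trace_smul, hX, smul_eq_mul, Finset.mul_sum]
    exact Finset.sum_congr rfl fun i _ => Finset.sum_congr rfl fun j _ => by
      rw [Matrix.trace_mul_comm]; ring
  rw [this]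
  exact (Matrix.posSemidef_conjTranspose_mul_self _).trace_nonneg

end PosSemidef

/-! ### Synchronous correlations as feasible matrices -/

section Feasible

variable {S A : Type*} [Fintype S] [Fintype A]

/-- The matrix with rows and columns indexed by question-answer pairs of a correlation. -/
def corrMatrix (p : A → A → S → S → ℝ) : Matrix (S × A) (S × A) ℝ :=
  Matrix.of fun i j => p i.2 j.2 i.1 j.1

/-- The feasible region of the doubly nonnegative program `ν(DNN, G)`. -/
def feasible (S A : Type*) [Fintype A] : Set (Matrix (S × A) (S × A) ℝ) :=
  {X | X ∈ doublyNonneg (S × A) ∧ (∀ s s', ∑ a, ∑ a', X (s, a) (s', a') = 1) ∧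
    ∀ s a a', a ≠ a' → X (s, a) (s, a') = 0}

lemma nuValue_eq_winProb (G : NonlocalGame S S A A) {p : A → A → S → S → ℝ}
    (hp : corrMatrix p ∈ feasible S A) :
    (1 / 2 : ℝ) * ((G.costMatrix + G.costMatrixᵀ) * corrMatrix p).trace = G.winProb p := by
  have hs : (corrMatrix p)ᵀ = corrMatrix p := by
    have := hp.1.1.isHermitian.eq
    rwa [Matrix.conjTranspose_eq_transpose_of_trivial] at this
  have h1 : (G.costMatrix * corrMatrix p).trace = (G.costMatrixᵀ * corrMatrix p).trace := by
    rw [← Matrix.trace_transpose, Matrix.transpose_mul, hs, Matrix.trace_mul_comm]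
  have h2 : (G.costMatrix * corrMatrix p).trace = G.winProb p := by
    conv_lhs => rw [← hs]
    simp only [Matrix.trace, Matrix.diag, Matrix.mul_apply, Matrix.transpose_apply, corrMatrix,
      costMatrix, Matrix.of_apply, Fintype.sum_prod_type, winProb, Finset.mul_sum]
    refine Finset.sum_congr rfl fun s _ => ?_
    rw [Finset.sum_comm]
    exact Finset.sum_congr rfl fun t _ => Finset.sum_congr rfl fun a _ =>
      Finset.sum_congr rfl fun b _ => by ring
  rw [Matrix.add_mul, Matrix.trace_add, ← h1, h2]
  ring

/-- Let `x_a`, `y_a` be Gram vectors of the two players for one question. Nonnegativity and block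
sums 1 give `∑ ‖x_a‖² ≤ 1` and `∑ ‖y_a‖² ≤ 1`, while synchrony gives `∑ ⟨x_a, y_a⟩ = 1`. Hence `∑
‖x_a - y_a‖² ≤ 0` and the two families agree. -/
lemma corrMatrix_mem_feasible_of_conic {p : A → A → S → S → ℝ}
    (hp : p ∈ conicCorrelations (doublyNonneg ((S × A) ⊕ (S × A))))
    (hsync : p ∈ synchronousCorrelations S A) : corrMatrix p ∈ feasible S A := by
  obtain ⟨X, ⟨hX, hX0⟩, hb, hXp⟩ := hp
  obtain ⟨⟨hp0, hp1⟩, hz⟩ := hsync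
  have hsymm : ∀ i j, X i j = X j i := fun i j => by
    have := congrFun (congrFun hX.isHermitian.eq j) i
    simpa using this
  have hdiag : ∀ s, ∑ a, p a a s s = 1 := fun s => by
    rw [← hp1 s s]
    refine Finset.sum_congr rfl fun a _ => ?_
    rw [Finset.sum_eq_single a (fun b _ h => hz s a b h.symm) (by simp)]
  have hquad : ∀ s a, X (.inl (s, a)) (.inl (s, a)) + X (.inr (s, a)) (.inr (s, a))
      - X (.inl (s, a)) (.inr (s, a)) - X (.inr (s, a)) (.inl (s, a)) = 0 := by
    intro s
    have key : ∀ g : A → (S × A) ⊕ (S × A), ∑ a, X (g a) (g a) ≤ ∑ a, ∑ a', X (g a) (g a') :=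
      fun g => Finset.sum_le_sum fun a _ =>
        Finset.single_le_sum (f := fun a' => X (g a) (g a')) (fun _ _ => hX0 _ _)
          (Finset.mem_univ a)
    have h1 := key fun a => .inl (s, a)
    have h2 := key fun a => .inr (s, a)
    have e1 : ∑ a, ∑ a', X (.inl (s, a)) (.inl (s, a')) = 1 := hb (.inl s) (.inl s)
    have e2 : ∑ a, ∑ a', X (.inr (s, a)) (.inr (s, a')) = 1 := hb (.inr s) (.inr s)
    rw [e1] at h1
    rw [e2] at h2
    have h3 : ∑ a, X (.inl (s, a)) (.inr (s, a)) = 1 := by simp only [hXp, hdiag]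
    have h4 : ∑ a, X (.inr (s, a)) (.inl (s, a)) = 1 := by
      rw [← h3]; exact Finset.sum_congr rfl fun a _ => hsymm _ _
    have hnn : ∀ a, 0 ≤ X (.inl (s, a)) (.inl (s, a)) + X (.inr (s, a)) (.inr (s, a))
      - X (.inl (s, a)) (.inr (s, a)) - X (.inr (s, a)) (.inl (s, a)) := by
      classical
      intro a
      have := hX.dotProduct_mulVec_nonneg
        (Pi.single (.inl (s, a)) 1 - Pi.single (.inr (s, a)) 1)
      simp [Matrix.mulVec_sub, sub_dotProduct] at this
      linarith
    have hsum : ∑ a, (X (.inl (s, a)) (.inl (s, a)) + X (.inr (s, a)) (.inr (s, a))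
      - X (.inl (s, a)) (.inr (s, a)) - X (.inr (s, a)) (.inl (s, a))) = 0 := by
      refine le_antisymm ?_ (Finset.sum_nonneg fun a _ => hnn a)
      simp only [Finset.sum_sub_distrib, Finset.sum_add_distrib]
      linarith
    intro a
    exact (Finset.sum_eq_zero_iff_of_nonneg fun a _ => hnn a).1 hsum a (Finset.mem_univ a)
  have hcol : ∀ s a k, X k (.inl (s, a)) = X k (.inr (s, a)) := by
    intro s a k
    simpa using sum_col_eq_of_posSemidef hX (fun _ : Unit => .inl (s, a))
      (fun _ : Unit => .inr (s, a)) (by simpa using hquad s a) k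
  have hEq : corrMatrix p = X.submatrix Sum.inl Sum.inl := by
    ext ⟨s, a⟩ ⟨t, b⟩
    simp [corrMatrix, hcol, hXp]
  exact ⟨⟨hEq ▸ hX.submatrix _, fun i j => hp0 _ _ _ _⟩, fun s t => hp1 s t, hz⟩

/-- Synchrony gives `(X_a ⊗ 1)ψ = (X_a ⊗ Y_a)ψ = (1 ⊗ Y_a)ψ`, so either player's operator produces
the same vector `u` and `p` is the Gram matrix of these vectors. The measurements need not be
projective. -/
lemma corrMatrix_mem_feasible_of_quantum {p : A → A → S → S → ℝ}
    (hp : p ∈ quantumCorrelations S S A A)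
    (hsync : p ∈ synchronousCorrelations S A) : corrMatrix p ∈ feasible S A := by
  obtain ⟨m, n, ψ, X, Y, -, hX, hX1, hY, hY1, hXY⟩ := hp
  obtain ⟨⟨hp0, hp1⟩, hz⟩ := hsync
  set u : S × A → Fin m × Fin n → ℂ :=
    fun i => (X i.1 i.2 ⊗ₖ (1 : Matrix (Fin n) (Fin n) ℂ)) *ᵥ ψ with hu
  have hE1 : ∀ s, ∑ a, X s a ⊗ₖ (1 : Matrix (Fin n) (Fin n) ℂ) = 1 := by
    intro s
    rw [← Matrix.one_kronecker_one, ← hX1 s]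
    ext i j
    simp [Matrix.sum_apply, Finset.sum_mul]
  have hF1 : ∀ s, ∑ a, (1 : Matrix (Fin m) (Fin m) ℂ) ⊗ₖ Y s a = 1 := by
    intro s
    rw [← Matrix.one_kronecker_one, ← hY1 s]
    ext i j
    simp [Matrix.sum_apply, Finset.mul_sum]
  -- A positive semidefinite operator with zero expectation at `ψ` annihilates `ψ`.
  have hne : ∀ s a b, a ≠ b → (X s a ⊗ₖ Y s b) *ᵥ ψ = 0 := by
    intro s a b hab
    refine (((hX s a).kronecker (hY s b)).dotProduct_mulVec_zero_iff ψ).1 ?_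
    rw [← hXY, hz s a b hab, Complex.ofReal_zero]
  have hv : ∀ s a, ((1 : Matrix (Fin m) (Fin m) ℂ) ⊗ₖ Y s a) *ᵥ ψ = u (s, a) := by
    intro s a
    have h1 : ((1 : Matrix (Fin m) (Fin m) ℂ) ⊗ₖ Y s a) *ᵥ ψ = (X s a ⊗ₖ Y s a) *ᵥ ψ := by
      conv_lhs => rw [← Matrix.one_mul ((1 : Matrix (Fin m) (Fin m) ℂ) ⊗ₖ Y s a), ← hE1 s]
      simp only [Matrix.sum_mul, ← Matrix.mul_kronecker_mul, Matrix.one_mul, Matrix.mul_one,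
        Matrix.sum_mulVec]
      exact Finset.sum_eq_single a (fun b _ h => hne s b a h) (by simp)
    have h2 : u (s, a) = (X s a ⊗ₖ Y s a) *ᵥ ψ := by
      simp only [hu]
      conv_lhs => rw [← Matrix.mul_one (X s a ⊗ₖ (1 : Matrix (Fin n) (Fin n) ℂ)), ← hF1 s]
      simp only [Matrix.mul_sum, ← Matrix.mul_kronecker_mul, Matrix.one_mul, Matrix.mul_one,
        Matrix.sum_mulVec]
      exact Finset.sum_eq_single a (fun b _ h => hne s a b h.symm) (by simp)
    rw [h1, h2]
  have hgram : ∀ i j, (corrMatrix p i j : ℂ) = star (u i) ⬝ᵥ u j := by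
    rintro ⟨s, a⟩ ⟨t, b⟩
    have hH : (X s a ⊗ₖ (1 : Matrix (Fin n) (Fin n) ℂ))ᴴ = X s a ⊗ₖ 1 := by
      rw [Matrix.conjTranspose_kronecker, (hX s a).isHermitian.eq, Matrix.conjTranspose_one]
    rw [← hv t b]
    simp only [corrMatrix, Matrix.of_apply, hXY, hu, Matrix.star_mulVec, hH,
      ← Matrix.dotProduct_mulVec, Matrix.mulVec_mulVec, ← Matrix.mul_kronecker_mul,
      Matrix.one_mul, Matrix.mul_one]
  -- The Gram matrix is a priori only Hermitian; symmetry comes from `p` being real.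
  have hsymm : ∀ i j, corrMatrix p i j = corrMatrix p j i := by
    intro i j
    apply Complex.ofReal_injective
    have h := congrArg star (hgram j i)
    rw [← Matrix.star_dotProduct_star, star_star] at h
    simp only [Complex.star_def, Complex.conj_ofReal] at h
    rw [hgram i j, h, dotProduct_comm]
  refine ⟨⟨posSemidef_of_sum_nonneg hsymm fun c => ?_, fun i j => hp0 _ _ _ _⟩,
    fun s t => hp1 s t, hz⟩
  have h : ((∑ i, ∑ j, c i * c j * corrMatrix p i j : ℝ) : ℂ)
      = star (∑ i, (c i : ℂ) • u i) ⬝ᵥ ∑ i, (c i : ℂ) • u i := by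
    push_cast
    simp only [star_sum, star_smul, sum_dotProduct, dotProduct_sum, smul_dotProduct,
      dotProduct_smul, hgram, smul_eq_mul, Complex.star_def, Complex.conj_ofReal,
      Finset.mul_sum]
    rw [Finset.sum_comm]
    exact Finset.sum_congr rfl fun i _ => Finset.sum_congr rfl fun j _ => by ring
  have h0 := dotProduct_star_self_nonneg (∑ i, (c i : ℂ) • u i)
  rw [← h] at h0
  exact_mod_cast h0

end Feasible

/-! ### Deterministic and classical strategies -/

section Deterministic

variable {S A : Type*}

open Classical in
/-- The correlation of the deterministic strategy in which both players answer `f s` to `s`. -/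
noncomputable def detCorr (f : S → A) : A → A → S → S → ℝ :=
  fun a b s t => (if f s = a then 1 else 0) * (if f t = b then 1 else 0)

variable [Fintype A]

lemma detCorr_mem_synchronous (f : S → A) : detCorr f ∈ synchronousCorrelations S A := by
  classical
  refine ⟨⟨fun a b s t => ?_, fun s t => ?_⟩, fun s a a' h => ?_⟩
  · unfold detCorr; positivity
  · simp [detCorr]
  · by_cases h1 : f s = a
    · simp [detCorr, h1, h]
    · simp [detCorr, h1]

lemma detCorr_mem_classical (f : S → A) : detCorr f ∈ classicalCorrelations S S A A := by
  classical
  refine ⟨1, fun _ => 1, fun s _ a => if f s = a then 1 else 0,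
    fun s _ a => if f s = a then 1 else 0, by simp, ?_, ?_, by simp, by simp, by simp,
    by simp [detCorr]⟩ <;>
  · intros; positivity

lemma detCorr_mem_quantum (f : S → A) : detCorr f ∈ quantumCorrelations S S A A := by
  classical
  have hpos : ∀ s a, (if f s = a then (1 : Matrix (Fin 1) (Fin 1) ℂ) else 0).PosSemidef := by
    intro s a
    split_ifs
    exacts [.one, .zero]
  refine ⟨1, 1, 1, fun s a => if f s = a then 1 else 0, fun s a => if f s = a then 1 else 0,
    by simp [dotProduct], hpos, by simp, hpos, by simp, fun a b s t => ?_⟩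
  by_cases h1 : f s = a <;> by_cases h2 : f t = b <;>
    simp [detCorr, h1, h2, dotProduct]

/-- Gram matrices of nonnegative vectors are Gram matrices of diagonal matrices. -/
lemma completelyPositive_subset_completelyPSD (ι : Type*) :
    completelyPositive ι ⊆ completelyPSD ι := by
  rintro X ⟨d, hd, x, hx, hX⟩
  refine ⟨d, hd, fun i => Matrix.diagonal (x i), fun i => .diagonal (hx i), fun i j => ?_⟩
  simp [hX, Matrix.diagonal_mul_diagonal, Matrix.trace_diagonal, dotProduct]

lemma conicCorrelations_mono
    {K L : Set (Matrix ((S × A) ⊕ (S × A)) ((S × A) ⊕ (S × A)) ℝ)} (h : K ⊆ L) :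
    conicCorrelations K ⊆ conicCorrelations L :=
  fun _ ⟨X, hX, hp⟩ => ⟨X, h hX, hp⟩

/-- The shared randomness is split evenly: each player's vector has coordinates `√kᵢ` times the
local probability, so inner products recover the weight `kᵢ`. -/
lemma classical_subset_conic_completelyPositive :
    classicalCorrelations S S A A ⊆
      conicCorrelations (completelyPositive ((S × A) ⊕ (S × A))) := by
  rintro p ⟨n, k, x, y, hk, hx, hy, hk1, hx1, hy1, hp⟩
  have hn : 1 ≤ n := by
    rcases Nat.eq_zero_or_pos n with rfl | h
    · simp at hk1
    · exact h
  have hsq : ∀ i, √(k i) * √(k i) = k i := fun i => Real.mul_self_sqrt (hk i)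
  have hmix : ∀ z w : Fin n → A → ℝ, (∀ i, ∑ a, z i a = 1) → (∀ i, ∑ a, w i a = 1) →
      ∑ a, ∑ b, ∑ i, √(k i) * z i a * (√(k i) * w i b) = 1 := by
    intro z w hz hw
    rw [← hk1]
    have : ∀ a, ∑ b, ∑ i, √(k i) * z i a * (√(k i) * w i b) = ∑ i, k i * z i a := by
      intro a
      rw [Finset.sum_comm]
      refine Finset.sum_congr rfl fun i _ => ?_
      rw [← Finset.mul_sum, ← Finset.mul_sum, hw, mul_one, mul_right_comm, hsq]
    simp only [this]
    rw [Finset.sum_comm]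
    exact Finset.sum_congr rfl fun i _ => by rw [← Finset.mul_sum, hz, mul_one]
  set v : (S × A) ⊕ (S × A) → Fin n → ℝ :=
    Sum.elim (fun j i => √(k i) * x j.1 i j.2) (fun j i => √(k i) * y j.1 i j.2) with hv
  refine ⟨Matrix.of fun i j => v i ⬝ᵥ v j, ⟨n, hn, v, ?_, fun _ _ => rfl⟩, ?_, ?_⟩
  · rintro (⟨s, a⟩ | ⟨s, a⟩) i
    exacts [mul_nonneg (Real.sqrt_nonneg _) (hx _ _ _),
      mul_nonneg (Real.sqrt_nonneg _) (hy _ _ _)]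
  · rintro (s | s) (t | t)
    exacts [hmix (x s) (x t) (hx1 s) (hx1 t), hmix (x s) (y t) (hx1 s) (hy1 t),
      hmix (y s) (x t) (hy1 s) (hx1 t), hmix (y s) (y t) (hy1 s) (hy1 t)]
  · intro a b s t
    rw [hp]
    change ∑ i, √(k i) * x s i a * (√(k i) * y t i b) = _
    refine Finset.sum_congr rfl fun i _ => ?_
    linear_combination (x s i a * y t i b) * hsq i

lemma corrMatrix_mem_feasible_of_classical [Fintype S] {p : A → A → S → S → ℝ}
    (hp : p ∈ classicalCorrelations S S A A) (hsync : p ∈ synchronousCorrelations S A) :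
    corrMatrix p ∈ feasible S A :=
  corrMatrix_mem_feasible_of_conic (conicCorrelations_mono
    completelyPositive_subset_doublyNonneg (classical_subset_conic_completelyPositive hp)) hsync

end Deterministic

/-! ### Two questions: decomposition and optimal values -/

section TwoQuestions

variable {S A : Type*} [Fintype S] [Fintype A]

/-- The Gram vectors of a question have a sum independent of the question, since two such sums are
at squared distance `1 + 1 - 1 - 1`. Thus `t` may be replaced by `s`, where the block is diagonal.
-/
lemma row_sum_of_mem_feasible {X : Matrix (S × A) (S × A) ℝ} (hX : X ∈ feasible S A)
    (s t : S) (a : A) : ∑ b, X (s, a) (t, b) = X (s, a) (s, a) := by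
  obtain ⟨⟨hpsd, -⟩, hb, hz⟩ := hX
  rw [sum_col_eq_of_posSemidef hpsd (fun b => (t, b)) (fun b => (s, b))
    (by simp only [hb]; norm_num) (s, a)]
  exact Finset.sum_eq_single a (fun b _ h => hz s a b h.symm) (by simp)

/-- With two questions, a feasible matrix is a mixture of deterministic strategies. -/
lemma exists_mixture_of_mem_feasible (hS : Fintype.card S = 2) {X : Matrix (S × A) (S × A) ℝ}
    (hX : X ∈ feasible S A) :
    ∃ (q : A × A → ℝ) (g : A × A → S → A), (∀ i, 0 ≤ q i) ∧ ∑ i, q i = 1 ∧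
      ∀ s a t b, X (s, a) (t, b) = ∑ i, q i * detCorr (g i) a b s t := by
  classical
  obtain ⟨s₀, s₁, hne, huniv⟩ := Finset.card_eq_two.1 hS
  have hcases : ∀ s : S, s = s₀ ∨ s = s₁ := fun s => by
    simpa [huniv] using Finset.mem_univ s
  have hrow := row_sum_of_mem_feasible hX
  obtain ⟨⟨hpsd, h0⟩, hb, hz⟩ := hX
  have hsymm : ∀ i j, X i j = X j i := fun i j => by
    simpa using congrFun (congrFun hpsd.isHermitian.eq j) i
  have hdiag : ∀ s a b, X (s, a) (s, b) = if b = a then X (s, b) (s, b) else 0 := by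
    intro s a b
    split_ifs with h
    · rw [h]
    · exact hz s a b (Ne.symm h)
  have hcol : ∀ a, ∑ c, X (s₀, c) (s₁, a) = X (s₁, a) (s₁, a) := by
    intro a
    rw [← hrow s₁ s₀ a]
    exact Finset.sum_congr rfl fun c _ => hsymm _ _
  -- The off-diagonal block serves as a joint distribution of the answers to `s₀` and `s₁`. Its
  -- marginals are the diagonals of the two remaining blocks.
  refine ⟨fun i => X (s₀, i.1) (s₁, i.2), fun i s => if s = s₀ then i.1 else i.2,
    fun i => h0 _ _, by rw [Fintype.sum_prod_type]; exact hb _ _, fun s a t b => ?_⟩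
  rw [Fintype.sum_prod_type]
  rcases hcases s with rfl | rfl <;> rcases hcases t with rfl | rfl
  · simp only [detCorr, if_true, ← Finset.sum_mul, hrow]
    rw [hdiag]
    simp
  · simp [detCorr, hne.symm]
  · simp [detCorr, hne.symm, hsymm (s, a)]
  · rw [Finset.sum_comm]
    simp only [detCorr, hne.symm, if_false, ← Finset.sum_mul, hcol]
    rw [hdiag]
    simp

lemma winProb_mixture {κ : Type*} [Fintype κ] (G : NonlocalGame S S A A)
    {p : A → A → S → S → ℝ} (q : κ → ℝ) (r : κ → A → A → S → S → ℝ)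
    (h : ∀ a b s t, p a b s t = ∑ i, q i * r i a b s t) :
    G.winProb p = ∑ i, q i * G.winProb (r i) := by
  simp only [winProb, h, Finset.mul_sum]
  symm
  rw [Finset.sum_comm]
  refine Finset.sum_congr rfl fun s _ => ?_
  rw [Finset.sum_comm]
  refine Finset.sum_congr rfl fun t _ => ?_
  rw [Finset.sum_comm]
  refine Finset.sum_congr rfl fun a _ => ?_
  rw [Finset.sum_comm]
  exact Finset.sum_congr rfl fun b _ => Finset.sum_congr rfl fun i _ => by ring

/-- An upper bound on deterministic winning probabilities bounds the doubly nonnegative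
program. -/
lemma winProb_le_of_mem_feasible (hS : Fintype.card S = 2) (G : NonlocalGame S S A A) {M : ℝ}
    (hM : ∀ f : S → A, G.winProb (detCorr f) ≤ M) {p : A → A → S → S → ℝ}
    (hp : corrMatrix p ∈ feasible S A) : G.winProb p ≤ M := by
  obtain ⟨q, g, hq, hq1, hX⟩ := exists_mixture_of_mem_feasible hS hp
  rw [winProb_mixture (p := p) G q (fun i => detCorr (g i)) fun a b s t => hX s a t b]
  calc ∑ i, q i * G.winProb (detCorr (g i)) ≤ ∑ i, q i * M :=
        Finset.sum_le_sum fun i _ => mul_le_mul_of_nonneg_left (hM _) (hq i)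
    _ = M := by rw [← Finset.sum_mul, hq1, one_mul]

lemma isGreatest_syncWinProbs (hS : Fintype.card S = 2) (G : NonlocalGame S S A A) {f : S → A}
    (hf : ∀ f' : S → A, G.winProb (detCorr f') ≤ G.winProb (detCorr f))
    {𝒮 : Set (A → A → S → S → ℝ)} (hdet : detCorr f ∈ 𝒮)
    (hfeas : ∀ p ∈ 𝒮, p ∈ synchronousCorrelations S A → corrMatrix p ∈ feasible S A) :
    IsGreatest (G.syncWinProbs 𝒮) (G.winProb (detCorr f)) := by
  refine ⟨⟨_, ⟨hdet, detCorr_mem_synchronous f⟩, rfl⟩, ?_⟩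
  rintro _ ⟨p, ⟨hp, hs⟩, rfl⟩
  exact winProb_le_of_mem_feasible hS G hf (hfeas p hp hs)

lemma isGreatest_nuValues (hS : Fintype.card S = 2) (G : NonlocalGame S S A A) {f : S → A}
    (hf : ∀ f' : S → A, G.winProb (detCorr f') ≤ G.winProb (detCorr f)) :
    IsGreatest (nuValues (doublyNonneg _) G) (G.winProb (detCorr f)) := by
  have hdet := corrMatrix_mem_feasible_of_classical (detCorr_mem_classical f)
    (detCorr_mem_synchronous f)
  refine ⟨⟨corrMatrix (detCorr f), hdet, nuValue_eq_winProb G hdet⟩, ?_⟩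
  rintro _ ⟨X, hX, rfl⟩
  have hX' : corrMatrix (fun a b s t => X (s, a) (t, b)) ∈ feasible S A := hX
  exact (nuValue_eq_winProb G hX').trans_le (winProb_le_of_mem_feasible hS G hf hX')

/-- A deterministic strategy optimal among the deterministic ones attains all five values. -/
lemma isGreatest_values (hS : Fintype.card S = 2) (G : NonlocalGame S S A A) {f : S → A}
    (hf : ∀ f' : S → A, G.winProb (detCorr f') ≤ G.winProb (detCorr f)) :
    IsGreatest (G.syncWinProbs (conicCorrelations (completelyPositive _)))
      (G.winProb (detCorr f)) ∧
    IsGreatest (G.syncWinProbs (conicCorrelations (completelyPSD _))) (G.winProb (detCorr f)) ∧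
    IsGreatest (G.syncWinProbs (classicalCorrelations S S A A)) (G.winProb (detCorr f)) ∧
    IsGreatest (G.syncWinProbs (quantumCorrelations S S A A)) (G.winProb (detCorr f)) ∧
    IsGreatest (nuValues (doublyNonneg _) G) (G.winProb (detCorr f)) := by
  have hcp := classical_subset_conic_completelyPositive (detCorr_mem_classical f)
  exact ⟨isGreatest_syncWinProbs hS G hf hcp fun p hp => corrMatrix_mem_feasible_of_conic
      (conicCorrelations_mono completelyPositive_subset_doublyNonneg hp),
    isGreatest_syncWinProbs hS G hf
      (conicCorrelations_mono (completelyPositive_subset_completelyPSD _) hcp)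
      fun p hp => corrMatrix_mem_feasible_of_conic
        (conicCorrelations_mono completelyPSD_subset_doublyNonneg hp),
    isGreatest_syncWinProbs hS G hf (detCorr_mem_classical f)
      fun p hp => corrMatrix_mem_feasible_of_classical hp,
    isGreatest_syncWinProbs hS G hf (detCorr_mem_quantum f)
      fun p hp => corrMatrix_mem_feasible_of_quantum hp,
    isGreatest_nuValues hS G hf⟩

end TwoQuestions

/-! ### The CHSH game -/

lemma winProb_chsh_detCorr (f : Bool → Bool) :
    chsh.winProb (detCorr f) = if f false = f true then 3 / 4 else 1 / 4 := by
  classical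
  -- Equal answers lose on the question pair (1,1). A constant `f` wins the other three pairs; a
  -- nonconstant one wins only (0,0).
  cases h0 : f false <;> cases h1 : f true <;>
    simp [winProb, chsh, detCorr, h0, h1] <;> norm_num

lemma winProb_chsh_detCorr_const : chsh.winProb (detCorr fun _ => false) = 3 / 4 := by
  simp [winProb_chsh_detCorr]

lemma winProb_chsh_detCorr_le (f : Bool → Bool) :
    chsh.winProb (detCorr f) ≤ chsh.winProb (detCorr fun _ => false) := by
  rw [winProb_chsh_detCorr_const, winProb_chsh_detCorr]
  split_ifs <;> norm_num

end NonlocalGame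

theorem corollary5p7 :
    (∀ (S A : Type*) [Fintype S] [Fintype A], Fintype.card S = 2 → Fintype.card A = 2 →
      ∀ G : NonlocalGame S S A A,
        -- the synchronous classical and quantum values agree with the value of the SDP
        (conicSyncValue (completelyPositive _) G = conicSyncValue (completelyPSD _) G ∧
          conicSyncValue (completelyPSD _) G = nu (doublyNonneg _) G) ∧
        (G.syncValue (classicalCorrelations S S A A) = G.syncValue (quantumCorrelations S S A A) ∧
          G.syncValue (quantumCorrelations S S A A) = nu (doublyNonneg _) G) ∧
        -- all these suprema are attained
        IsGreatest (G.syncWinProbs (conicCorrelations (completelyPositive _)))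
          (conicSyncValue (completelyPositive _) G) ∧
        IsGreatest (G.syncWinProbs (conicCorrelations (completelyPSD _)))
          (conicSyncValue (completelyPSD _) G) ∧
        IsGreatest (G.syncWinProbs (classicalCorrelations S S A A))
          (G.syncValue (classicalCorrelations S S A A)) ∧
        IsGreatest (G.syncWinProbs (quantumCorrelations S S A A))
          (G.syncValue (quantumCorrelations S S A A)) ∧
        IsGreatest (nuValues (doublyNonneg _) G) (nu (doublyNonneg _) G)) ∧
    -- the CHSH game
    chsh.syncValue (quantumCorrelations Bool Bool Bool Bool) = 3 / 4 ∧
    chsh.syncValue (classicalCorrelations Bool Bool Bool Bool) = 3 / 4 ∧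
    conicSyncValue (completelyPSD _) chsh = 3 / 4 := by
  refine ⟨fun S A _ _ hS hA G => ?_, ?_⟩
  · have : Nonempty A := Fintype.card_pos_iff.1 (by omega)
    obtain ⟨f, hf⟩ := Finite.exists_max fun f : S → A => G.winProb (detCorr f)
    obtain ⟨h1, h2, h3, h4, h5⟩ := isGreatest_values hS G hf
    have e1 : conicSyncValue (completelyPositive _) G = _ := h1.csSup_eq
    have e2 : conicSyncValue (completelyPSD _) G = _ := h2.csSup_eq
    have e3 : G.syncValue (classicalCorrelations S S A A) = _ := h3.csSup_eq
    have e4 : G.syncValue (quantumCorrelations S S A A) = _ := h4.csSup_eq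
    have e5 : nu (doublyNonneg _) G = _ := h5.csSup_eq
    rw [e1, e2, e3, e4, e5]
    exact ⟨⟨rfl, rfl⟩, ⟨rfl, rfl⟩, h1, h2, h3, h4, h5⟩
  · obtain ⟨-, h2, h3, h4, -⟩ := isGreatest_values (by simp) chsh winProb_chsh_detCorr_le
    rw [winProb_chsh_detCorr_const] at h2 h3 h4
    exact ⟨h4.csSup_eq, h3.csSup_eq, h2.csSup_eq⟩
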